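/- Let $0\le m\le n$ be integers, $\Pi=[0,1]\times\mathbb R$, let $r=(r_{jk})$ be a real $n\times n$ matrix, and for $v\in C([0,1];\mathbb R^n)$ put $R_jv=\sum_{k=m+1}^n r_{jk}v_k(0)+\sum_{k=1}^m r_{jk}v_k(1)$, $1\le j\le n$. Let $BC^1(\Pi;\mathbb M_n)$ be the space of continuously differentiable functions from $\Pi$ to the real $n\times n$ matrices that are bounded together with their first order partial derivatives, with the norm $\|f\|_{BC^1}=\sup_\Pi\|f\|+\sup_\Pi\|\partial_xf\|+\sup_\Pi\|\partial_tf\|$. Here $\|\cdot\|$ denotes the maximum norm of vectors and of matrices (largest modulus of an entry). Let $a=\mathrm{diag}(a_1,\dots,a_n)$ and $b$ belong to $BC^1(\Pi;\mathbb M_n)$. Consider the linear problem $$\partial_tu+a(x,t)\partial_xu+b(x,t)u=0,\quad x\in(0,1),\qquad(1)$$ $$u_j(0,t)=R_ju(\cdot,t)\ \ (1\le j\le m),\qquad u_j(1,t)=R_ju(\cdot,t)\ \ (m<j\le n).\qquad(2)$$ *Definitions.* For $s\in\mathbb R$ and $\varphi\in L^2((0,1);\mathbb R^n)$, an $L^2$-generalized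 solution of (1), (2) with $u(\cdot,s)=\varphi$ is a function $u\in C([s,\infty);L^2((0,1);\mathbb R^n))$ such that for every sequence $\varphi^l$ of $C^1$ functions with support inside $(0,1)$ and $\varphi^l\to\varphi$ in $L^2$ there are classical solutions $u^l\in C^1([0,1]\times[s,\infty);\mathbb R^n)$ of (1), (2) with $u^l(\cdot,s)=\varphi^l$ such that $\|u(\cdot,\theta)-u^l(\cdot,\theta)\|_{L^2}\to0$ as $l\to\infty$, uniformly in $\theta\in[s,s+s_1]$, for every $s_1>0$. The problem (1), (2) is *robust exponentially stable in $L^2$* if there exist $\gamma>0$, $M\ge1$ and $\alpha>0$ such that for all $s\in\mathbb R$, all $\varphi\in L^2((0,1);\mathbb R^n)$, all diagonal $\tilde a\in BC^1(\Pi;\mathbb M_n)$ and all $\tilde b\in BC^1(\Pi;\mathbb M_n)$ with $\|\tilde a-a\|_{BC^1}\le\gamma$ and $\|\tilde b-b\|_{BC^1}\le\gamma$, every $L^2$-generalized solution $\tilde u$ of (1), (2), with $a,b$ replaced by $\tilde a,\tilde b$ and with $\tilde u(\cdot,s)=\varphi$, satisfies $$\|\tilde u(\cdot,t)\|_{L^2}\le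 Me^{-\alpha(t-s)}\|\varphi\|_{L^2}\quad\text{for all }t\ge s.$$ Write $R_{11}=(r_{jk})_{j,k\le m}$, $R_{12}=(r_{jk})_{j\le m<k}$, $R_{21}=(r_{jk})_{k\le m<j}$, $R_{22}=(r_{jk})_{j,k>m}$ and $$J_0=\begin{bmatrix}R_{11}&R_{12}\\0&I\end{bmatrix},\qquad J_1=\begin{bmatrix}I&0\\R_{21}&R_{22}\end{bmatrix}.$$ **Theorem.** Assume that there exist positive constants $\beta_1,\beta_2,\beta_3,\beta_4$ and a diagonal matrix $V(x,t)=\mathrm{diag}(V_1(x,t),\dots,V_n(x,t))$ with entries that are continuously differentiable on $\Pi$ and have bounded derivatives $\partial_xV_j$, such that (i) $\beta_1\|v\|^2\le\langle V(x,t)v,v\rangle\le\beta_2\|v\|^2$ for all $(x,t)\in\Pi$ and $v\in\mathbb R^n$; (ii) $\langle(\partial_tV+\partial_x(Va)-Vb-b^TV)v,v\rangle\le-\beta_3\|v\|^2$ for all $(x,t)\in\Pi$ and $v\in\mathbb R^n$; (iii) $\langle(J_0^TV(0,t)a(0,t)J_0-J_1^TV(1,t)a(1,t)J_1)v,v\rangle\le-\beta_4\|v\|^2$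 for all $t\in\mathbb R$ and $v\in\mathbb R^n$. Then the problem (1), (2) is robust exponentially stable in $L^2((0,1);\mathbb R^n)$. -/

import Mathlib

open Set Filter Topology MeasureTheory
open scoped Matrix

namespace HypStrip

/-- Values of the unknown `u = (u_1, …, u_n)`. -/
abbrev Vec (n : ℕ) : Type := EuclideanSpace ℝ (Fin n)

/-- The space `L²((0,1); ℝⁿ)`. -/
abbrev L2 (n : ℕ) : Type := Lp (Vec n) 2 (volume.restrict (Ioo (0 : ℝ) 1))

/-- The closed strip `Π = {(x,t) : 0 ≤ x ≤ 1}`. -/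
def strip : Set (ℝ × ℝ) := Icc (0 : ℝ) 1 ×ˢ univ

/-- The partial derivative in `x` of a function on the strip (one-sided at `x = 0` and `x = 1`). -/
noncomputable def dx (f : ℝ → ℝ → ℝ) (x t : ℝ) : ℝ :=
  derivWithin (fun y => f y t) (Icc 0 1) x

/-- The partial derivative in `t` of a function on the strip. -/
noncomputable def dt (f : ℝ → ℝ → ℝ) (x t : ℝ) : ℝ :=
  deriv (fun τ => f x τ) t

/-- The entrywise partial derivative in `x` of a matrix function. -/
noncomputable def dxM {n : ℕ} (B : ℝ → ℝ → Matrix (Fin n) (Fin n) ℝ) (x t : ℝ) :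
    Matrix (Fin n) (Fin n) ℝ :=
  Matrix.of fun i j => dx (fun y τ => B y τ i j) x t

/-- The entrywise partial derivative in `t` of a matrix function. -/
noncomputable def dtM {n : ℕ} (B : ℝ → ℝ → Matrix (Fin n) (Fin n) ℝ) (x t : ℝ) :
    Matrix (Fin n) (Fin n) ℝ :=
  Matrix.of fun i j => dt (fun y τ => B y τ i j) x t

/-- The diagonal matrix function with diagonal `a = (a_1, …, a_n)`. -/
def diagM {n : ℕ} (a : ℝ → ℝ → Fin n → ℝ) (x t : ℝ) : Matrix (Fin n) (Fin n) ℝ :=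
  Matrix.diagonal (a x t)

/-- `f` is continuously differentiable on the closed strip. -/
def IsC1 (f : ℝ → ℝ → ℝ) : Prop :=
  ContDiffOn ℝ 1 (fun p : ℝ × ℝ => f p.1 p.2) strip

/-- `f` is bounded on the strip. -/
def BddOnStrip (f : ℝ → ℝ → ℝ) : Prop :=
  ∃ C : ℝ, ∀ x ∈ Icc (0 : ℝ) 1, ∀ t : ℝ, |f x t| ≤ C

/-- `B ∈ BC¹(Π; 𝕄_n)`: the entries are continuously differentiable, and they and their first order
partial derivatives are bounded. -/
def IsBC1 {n : ℕ} (B : ℝ → ℝ → Matrix (Fin n) (Fin n) ℝ) : Prop :=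
  ∀ i j : Fin n, IsC1 (fun x t => B x t i j) ∧ BddOnStrip (fun x t => B x t i j) ∧
    BddOnStrip (dx fun x t => B x t i j) ∧ BddOnStrip (dt fun x t => B x t i j)

/-- The norm of `BC(Π; 𝕄_n)`: the supremum over the strip of the largest modulus of an entry. -/
noncomputable def bcNorm {n : ℕ} (B : ℝ → ℝ → Matrix (Fin n) (Fin n) ℝ) : ℝ :=
  ⨆ q : (Icc (0 : ℝ) 1 × ℝ) × (Fin n × Fin n), |B q.1.1 q.1.2 q.2.1 q.2.2|

/-- The norm of `BC¹(Π; 𝕄_n)`. -/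
noncomputable def bc1Norm {n : ℕ} (B : ℝ → ℝ → Matrix (Fin n) (Fin n) ℝ) : ℝ :=
  bcNorm B + bcNorm (dxM B) + bcNorm (dtM B)

/-- The boundary operators `R_j v = ∑_{k > m} r_{jk} v_k(0) + ∑_{k ≤ m} r_{jk} v_k(1)`.
The index `k : Fin n` stands for the number `k + 1`, so `k ≤ m` becomes `(k : ℕ) < m`. -/
noncomputable def R {n : ℕ} (m : ℕ) (r : Matrix (Fin n) (Fin n) ℝ) (j : Fin n)
    (v : ℝ → Vec n) : ℝ :=
  ∑ k : Fin n, if (k : ℕ) < m then r j k * v 1 k else r j k * v 0 k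

/-- The block matrix `J₀ = [[R₁₁, R₁₂], [0, I]]`. -/
def J0 {n : ℕ} (m : ℕ) (r : Matrix (Fin n) (Fin n) ℝ) : Matrix (Fin n) (Fin n) ℝ :=
  Matrix.of fun j k => if (j : ℕ) < m then r j k else (1 : Matrix (Fin n) (Fin n) ℝ) j k

/-- The block matrix `J₁ = [[I, 0], [R₂₁, R₂₂]]`. -/
def J1 {n : ℕ} (m : ℕ) (r : Matrix (Fin n) (Fin n) ℝ) : Matrix (Fin n) (Fin n) ℝ :=
  Matrix.of fun j k => if (j : ℕ) < m then (1 : Matrix (Fin n) (Fin n) ℝ) j k else r j k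

/-- `u ∈ C¹([0,1] × [s,∞); ℝⁿ)` is a classical solution of the problem
`∂ₜu + a ∂ₓu + b u = 0` with `a = diag(a_1, …, a_n)`,
`u_j(0,t) = R_j u(·,t)` for `j ≤ m`, `u_j(1,t) = R_j u(·,t)` for `j > m`, `u(·,s) = φ`. -/
structure IsClassicalSolution {n : ℕ} (m : ℕ) (r : Matrix (Fin n) (Fin n) ℝ)
    (a : ℝ → ℝ → Fin n → ℝ) (b : ℝ → ℝ → Matrix (Fin n) (Fin n) ℝ) (s : ℝ)
    (φ : ℝ → Vec n) (u : ℝ → ℝ → Vec n) : Prop where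
  contDiffOn : ContDiffOn ℝ 1 (fun p : ℝ × ℝ => u p.1 p.2) (Icc (0 : ℝ) 1 ×ˢ Ici s)
  equation : ∀ x ∈ Ioo (0 : ℝ) 1, ∀ t ∈ Ioi s, ∀ j : Fin n,
    deriv (fun τ => u x τ j) t + a x t j * deriv (fun y => u y t j) x
      + ∑ k : Fin n, b x t j k * u x t k = 0
  boundary_left : ∀ t ∈ Ici s, ∀ j : Fin n, (j : ℕ) < m → u 0 t j = R m r j (fun x => u x t)
  boundary_right : ∀ t ∈ Ici s, ∀ j : Fin n, m ≤ (j : ℕ) → u 1 t j = R m r j (fun x => u x t)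
  initial : ∀ x ∈ Icc (0 : ℝ) 1, u x s = φ x

/-- `φ ∈ C₀¹([0,1]; ℝⁿ)`: a `C¹` function with support inside `(0,1)`, extended by zero. -/
def IsC01 {n : ℕ} (φ : ℝ → Vec n) : Prop :=
  ContDiff ℝ 1 φ ∧ tsupport φ ⊆ Ioo (0 : ℝ) 1

/-- `u ∈ C([s,∞); L²((0,1); ℝⁿ))` is an `L²`-generalized solution of the initial-boundary value
problem with initial value `φ` at time `s`: for every sequence `φ^l ∈ C₀¹` with `φ^l → φ` in `L²`,
the classical solutions `u^l` with initial values `φ^l` converge to `u` in `L²`, uniformly on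
`[s, s + s₁]` for every `s₁ > 0`. -/
def IsL2GeneralizedSolution {n : ℕ} (m : ℕ) (r : Matrix (Fin n) (Fin n) ℝ)
    (a : ℝ → ℝ → Fin n → ℝ) (b : ℝ → ℝ → Matrix (Fin n) (Fin n) ℝ) (s : ℝ)
    (φ : L2 n) (u : ℝ → L2 n) : Prop :=
  ContinuousOn u (Ici s) ∧
  ∀ φl : ℕ → ℝ → Vec n, (∀ l, IsC01 (φl l)) →
    Tendsto (fun l => eLpNorm (fun x => φl l x - φ x) 2 (volume.restrict (Ioo (0 : ℝ) 1)))
      atTop (𝓝 0) →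
    ∃ ul : ℕ → ℝ → ℝ → Vec n,
      (∀ l, IsClassicalSolution m r a b s (φl l) (ul l)) ∧
      ∀ s₁ > (0 : ℝ), ∀ ε > (0 : ℝ), ∀ᶠ l in atTop, ∀ θ ∈ Icc s (s + s₁),
        eLpNorm (fun x => u θ x - ul l x θ) 2 (volume.restrict (Ioo (0 : ℝ) 1))
          ≤ ENNReal.ofReal ε

/-- The boundary value problem with coefficients `a = diag(a_1, …, a_n)`, `b` and boundary
coefficients `r` is robust exponentially stable in `L²`. -/
def RobustExpStable {n : ℕ} (m : ℕ) (r : Matrix (Fin n) (Fin n) ℝ)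
    (a : ℝ → ℝ → Fin n → ℝ) (b : ℝ → ℝ → Matrix (Fin n) (Fin n) ℝ) : Prop :=
  ∃ γ > (0 : ℝ), ∃ M ≥ (1 : ℝ), ∃ α > (0 : ℝ),
    ∀ (s : ℝ) (φ : L2 n) (a' : ℝ → ℝ → Fin n → ℝ) (b' : ℝ → ℝ → Matrix (Fin n) (Fin n) ℝ),
      IsBC1 (diagM a') → IsBC1 b' →
      bc1Norm (fun x t => diagM a' x t - diagM a x t) ≤ γ →
      bc1Norm (fun x t => b' x t - b x t) ≤ γ →
      ∀ u : ℝ → L2 n, IsL2GeneralizedSolution m r a' b' s φ u →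
        ∀ t ≥ s, ‖u t‖ ≤ M * Real.exp (-α * (t - s)) * ‖φ‖

end HypStrip

/-!
The weighted energy `E(t) = ∫₀¹ ⟨V(x,t) u, u⟩ dx` is a Lyapunov function, and the three conditions
on `V` survive a small perturbation of the coefficients.

For a classical solution of the problem with coefficients `a`, `b`, the density `⟨Vu, u⟩` and the
flux `⟨Vau, u⟩` satisfy `∂ₜ⟨Vu, u⟩ + ∂ₓ⟨Vau, u⟩ = ⟨(∂ₜV + ∂ₓ(Va) - Vb - bᵀV) u, u⟩`
(`IsClassicalSolution.energy_identity`). The reflection conditions say that `u(0,t) = J₀ w` and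
`u(1,t) = J₁ w`, where `w` collects `u_k(1,t)` for `k ≤ m` and `u_k(0,t)` for `k > m`, so the net
inflow of energy through the boundary is the form of
`J₀ᵀ V(0,t) a(0,t) J₀ - J₁ᵀ V(1,t) a(1,t) J₁` at `w`. If the first form is at most `-c ⟨Vu, u⟩` and
the second is nonpositive, then `E' ≤ -c E`, hence `E(t) ≤ exp (-c (t - s)) E(s)`
(`integral_le_exp_of_dissipation`).

Both inequalities hold uniformly for all coefficients `a'`, `b'` that are `γ`-close to `a`, `b` in
`BC¹`, with `c = β₃ / (2 β₂)`. Indeed the entries of `V` lie in `[β₁, β₂]` and `∂ₓV` is bounded, so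
passing to `a'`, `b'` changes the interior form by at most a constant times `γ ‖v‖²`, as it does
the boundary form, while `∂ₜV` is not affected at all; a small `γ` leaves half of the interior
dissipation and preserves the sign of the boundary form (`interior_form_perturb`,
`boundary_form_perturb`). Since `E` is equivalent to the square of the `L²` norm, classical
solutions decay in `L²` with constants that depend only on `V` (`IsClassicalSolution.eLpNorm_le`).

A generalized solution inherits the estimate, because `C₀¹` is dense in `L²(0,1)`: its initial value
is the limit of a sequence in `C₀¹`, and the corresponding classical solutions converge to it at
every time (`exists_seq_isC01_tendsto`, `IsL2GeneralizedSolution.norm_le`).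
-/

namespace HypStrip

/-! ### Energy balance on the half-strip -/

lemma strip_hasDerivWithinAt_left {F : ℝ → ℝ → ℝ} {s : ℝ}
    (hF : ContDiffOn ℝ 1 (fun p : ℝ × ℝ => F p.1 p.2) (Icc (0 : ℝ) 1 ×ˢ Ici s))
    {x t : ℝ} (hx : x ∈ Icc (0 : ℝ) 1) (ht : t ∈ Ici s) :
    HasDerivWithinAt (fun y => F y t)
      (fderivWithin ℝ (fun p : ℝ × ℝ => F p.1 p.2) (Icc (0 : ℝ) 1 ×ˢ Ici s) (x, t) (1, 0))
      (Icc 0 1) x := by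
  have h := ((hF.differentiableOn one_ne_zero) (x, t) ⟨hx, ht⟩).hasFDerivWithinAt
  exact h.comp_hasDerivWithinAt (f := fun y : ℝ => (y, t)) x
    ((hasDerivWithinAt_id x _).prodMk (hasDerivWithinAt_const x _ t)) (fun y hy => ⟨hy, ht⟩)

lemma strip_hasDerivAt_right {F : ℝ → ℝ → ℝ} {s : ℝ}
    (hF : ContDiffOn ℝ 1 (fun p : ℝ × ℝ => F p.1 p.2) (Icc (0 : ℝ) 1 ×ˢ Ici s))
    {x t : ℝ} (hx : x ∈ Icc (0 : ℝ) 1) (ht : t ∈ Ioi s) :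
    HasDerivAt (fun τ => F x τ)
      (fderivWithin ℝ (fun p : ℝ × ℝ => F p.1 p.2) (Icc (0 : ℝ) 1 ×ˢ Ici s) (x, t) (0, 1)) t := by
  have h := ((hF.differentiableOn one_ne_zero) (x, t) ⟨hx, (mem_Ioi.1 ht).le⟩).hasFDerivWithinAt
  have h' := h.comp_hasDerivWithinAt (f := fun τ : ℝ => (x, τ)) (s := Ici s) t
    ((hasDerivWithinAt_const t _ x).prodMk (hasDerivWithinAt_id t _)) (fun y hy => ⟨hx, hy⟩)
  exact h'.hasDerivAt (Ici_mem_nhds ht)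

lemma uniqueDiffOn_halfStrip (s : ℝ) : UniqueDiffOn ℝ (Icc (0 : ℝ) 1 ×ˢ Ici s) :=
  (uniqueDiffOn_Icc zero_lt_one).prod (uniqueDiffOn_Ici s)

lemma continuousOn_slice {E : Type*} [TopologicalSpace E] {f : ℝ × ℝ → E} {s : ℝ}
    (hf : ContinuousOn f (Icc (0 : ℝ) 1 ×ˢ Ici s)) {t : ℝ} (ht : s ≤ t) :
    ContinuousOn (fun x => f (x, t)) (Icc (0 : ℝ) 1) :=
  hf.comp (f := fun x : ℝ => (x, t)) (by fun_prop) (fun _ hx => ⟨hx, ht⟩)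

lemma intervalIntegrable_slice {f : ℝ × ℝ → ℝ} {s : ℝ}
    (hf : ContinuousOn f (Icc (0 : ℝ) 1 ×ˢ Ici s)) {t : ℝ} (ht : s ≤ t) :
    IntervalIntegrable (fun x => f (x, t)) volume 0 1 := by
  apply ContinuousOn.intervalIntegrable
  rw [uIcc_of_le zero_le_one]
  exact continuousOn_slice hf ht

lemma exists_bound_halfStrip {f : ℝ × ℝ → ℝ} {s : ℝ}
    (hf : ContinuousOn f (Icc (0 : ℝ) 1 ×ˢ Ici s)) (T : ℝ) :
    ∃ C, ∀ x ∈ Icc (0 : ℝ) 1, ∀ t ∈ Icc s T, ‖f (x, t)‖ ≤ C := by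
  obtain ⟨C, hC⟩ := (isCompact_Icc.prod isCompact_Icc).exists_bound_of_continuousOn
    (hf.mono (prod_mono_right (fun _ h => h.1 : Icc s T ⊆ Ici s)))
  exact ⟨C, fun x hx t ht => hC (x, t) ⟨hx, ht⟩⟩

lemma continuousOn_integral_halfStrip {f : ℝ × ℝ → ℝ} {s : ℝ}
    (hf : ContinuousOn f (Icc (0 : ℝ) 1 ×ˢ Ici s)) :
    ContinuousOn (fun t => ∫ x in (0 : ℝ)..1, f (x, t)) (Ici s) := by
  intro t ht
  obtain ⟨C, hC⟩ := exists_bound_halfStrip hf (t + 1)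
  have hev : ∀ᶠ τ in 𝓝[Ici s] t, τ ∈ Icc s (t + 1) := by
    filter_upwards [self_mem_nhdsWithin,
      mem_nhdsWithin_of_mem_nhds (Iic_mem_nhds (lt_add_one t))] with τ h1 h2 using ⟨h1, h2⟩
  refine intervalIntegral.continuousWithinAt_of_dominated_interval (bound := fun _ => C) ?_ ?_
    intervalIntegrable_const ?_
  · filter_upwards [hev] with τ hτ
    exact (intervalIntegrable_slice hf hτ.1).aestronglyMeasurable_restrict_uIoc
  · filter_upwards [hev] with τ hτ
    refine Eventually.of_forall fun x hx => ?_
    rw [uIoc_of_le zero_le_one] at hx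
    exact hC x (Ioc_subset_Icc_self hx) τ hτ
  · refine Eventually.of_forall fun x hx => ?_
    rw [uIoc_of_le zero_le_one] at hx
    exact hf.comp (f := fun τ : ℝ => (x, τ)) (s := Ici s) (by fun_prop)
      (fun τ hτ => ⟨Ioc_subset_Icc_self hx, hτ⟩) t ht

lemma hasDerivAt_integral_halfStrip {F : ℝ → ℝ → ℝ} {s : ℝ}
    (hF : ContDiffOn ℝ 1 (fun p : ℝ × ℝ => F p.1 p.2) (Icc (0 : ℝ) 1 ×ˢ Ici s))
    {t : ℝ} (ht : s < t) :
    HasDerivAt (fun τ => ∫ x in (0 : ℝ)..1, F x τ)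
      (∫ x in (0 : ℝ)..1,
        fderivWithin ℝ (fun p : ℝ × ℝ => F p.1 p.2) (Icc (0 : ℝ) 1 ×ˢ Ici s) (x, t) (0, 1)) t := by
  have hD : ContinuousOn (fun p : ℝ × ℝ => fderivWithin ℝ (fun p : ℝ × ℝ => F p.1 p.2)
      (Icc (0 : ℝ) 1 ×ˢ Ici s) p (0, 1)) (Icc (0 : ℝ) 1 ×ˢ Ici s) :=
    (hF.continuousOn_fderivWithin (uniqueDiffOn_halfStrip s) le_rfl).clm_apply continuousOn_const
  obtain ⟨C, hC⟩ := exists_bound_halfStrip hD (t + 1)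
  refine (intervalIntegral.hasDerivAt_integral_of_dominated_loc_of_deriv_le
    (bound := fun _ => C) (s := Ioo s (t + 1)) (F := fun τ x => F x τ)
    (F' := fun τ x => fderivWithin ℝ (fun p : ℝ × ℝ => F p.1 p.2)
      (Icc (0 : ℝ) 1 ×ˢ Ici s) (x, τ) (0, 1)) (Ioo_mem_nhds ht (lt_add_one t)) ?_
    (intervalIntegrable_slice hF.continuousOn ht.le)
    (intervalIntegrable_slice hD ht.le).aestronglyMeasurable_restrict_uIoc ?_
    intervalIntegrable_const ?_).2
  · filter_upwards [Ioi_mem_nhds ht] with τ hτ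
    exact (intervalIntegrable_slice hF.continuousOn (le_of_lt hτ)).aestronglyMeasurable_restrict_uIoc
  · refine Eventually.of_forall fun x hx τ hτ => ?_
    rw [uIoc_of_le zero_le_one] at hx
    exact hC x (Ioc_subset_Icc_self hx) τ ⟨hτ.1.le, hτ.2.le⟩
  · refine Eventually.of_forall fun x hx τ hτ => ?_
    rw [uIoc_of_le zero_le_one] at hx
    exact strip_hasDerivAt_right hF (Ioc_subset_Icc_self hx) hτ.1

/-- A density `F` with flux `G` that satisfies the dissipation inequality `∂ₜF + ∂ₓG ≤ -cF` and
whose net inflow `G(0,t) - G(1,t)` is nonpositive has an exponentially decaying integral. -/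
theorem integral_le_exp_of_dissipation {F G : ℝ → ℝ → ℝ} {s c : ℝ}
    (hF : ContDiffOn ℝ 1 (fun p : ℝ × ℝ => F p.1 p.2) (Icc (0 : ℝ) 1 ×ˢ Ici s))
    (hG : ContDiffOn ℝ 1 (fun p : ℝ × ℝ => G p.1 p.2) (Icc (0 : ℝ) 1 ×ˢ Ici s))
    (hdiss : ∀ x ∈ Ioo (0 : ℝ) 1, ∀ t ∈ Ioi s,
      deriv (fun τ => F x τ) t + deriv (fun y => G y t) x ≤ -c * F x t)
    (hbd : ∀ t ∈ Ioi s, G 0 t ≤ G 1 t) {t : ℝ} (ht : s ≤ t) :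
    ∫ x in (0 : ℝ)..1, F x t ≤ Real.exp (-c * (t - s)) * ∫ x in (0 : ℝ)..1, F x s := by
  have hDF : ContinuousOn (fun p : ℝ × ℝ => fderivWithin ℝ (fun p : ℝ × ℝ => F p.1 p.2)
      (Icc (0 : ℝ) 1 ×ˢ Ici s) p (0, 1)) (Icc (0 : ℝ) 1 ×ˢ Ici s) :=
    (hF.continuousOn_fderivWithin (uniqueDiffOn_halfStrip s) le_rfl).clm_apply continuousOn_const
  have hDG : ContinuousOn (fun p : ℝ × ℝ => fderivWithin ℝ (fun p : ℝ × ℝ => G p.1 p.2)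
      (Icc (0 : ℝ) 1 ×ˢ Ici s) p (1, 0)) (Icc (0 : ℝ) 1 ×ˢ Ici s) :=
    (hG.continuousOn_fderivWithin (uniqueDiffOn_halfStrip s) le_rfl).clm_apply continuousOn_const
  have hexp : ∀ τ : ℝ, HasDerivAt (fun τ => Real.exp (c * (τ - s)))
      (Real.exp (c * (τ - s)) * c) τ := fun τ => by
    simpa using (((hasDerivAt_id τ).sub_const s).const_mul c).exp
  have hprod : ∀ τ ∈ Ioi s, HasDerivAt
      (fun τ => Real.exp (c * (τ - s)) * ∫ x in (0 : ℝ)..1, F x τ) _ τ :=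
    fun τ hτ => (hexp τ).mul (hasDerivAt_integral_halfStrip hF hτ)
  -- The weighted energy `exp (c (τ - s)) ∫ F` is nonincreasing.
  have hanti : AntitoneOn (fun τ => Real.exp (c * (τ - s)) * ∫ x in (0 : ℝ)..1, F x τ) (Ici s) := by
    refine antitoneOn_of_deriv_nonpos (convex_Ici s)
      ((by fun_prop : Continuous fun τ => Real.exp (c * (τ - s))).continuousOn.mul
        (continuousOn_integral_halfStrip hF.continuousOn)) ?_ ?_
    · rw [interior_Ici]
      exact fun τ hτ => (hprod τ hτ).differentiableAt.differentiableWithinAt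
    · rw [interior_Ici]
      intro τ hτ
      rw [(hprod τ hτ).deriv]
      have hτ' : s ≤ τ := le_of_lt hτ
      have hflux := intervalIntegral.integral_eq_sub_of_hasDerivAt_of_le zero_le_one
        (f := fun x => G x τ) (continuousOn_slice hG.continuousOn hτ')
        (fun x hx => (strip_hasDerivWithinAt_left hG (Ioo_subset_Icc_self hx) hτ').hasDerivAt
          (Icc_mem_nhds hx.1 hx.2)) (intervalIntegrable_slice hDG hτ')
      have hle : ∫ x in (0 : ℝ)..1, (fderivWithin ℝ (fun p : ℝ × ℝ => F p.1 p.2)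
            (Icc (0 : ℝ) 1 ×ˢ Ici s) (x, τ) (0, 1) + fderivWithin ℝ (fun p : ℝ × ℝ => G p.1 p.2)
            (Icc (0 : ℝ) 1 ×ˢ Ici s) (x, τ) (1, 0)) ≤ ∫ x in (0 : ℝ)..1, -c * F x τ := by
        refine intervalIntegral.integral_mono_on_of_le_Ioo zero_le_one
          ((intervalIntegrable_slice hDF hτ').add (intervalIntegrable_slice hDG hτ'))
          ((intervalIntegrable_slice hF.continuousOn hτ').const_mul _) fun x hx => ?_
        have h := hdiss x hx τ hτ
        rwa [(strip_hasDerivAt_right hF (Ioo_subset_Icc_self hx) hτ).deriv,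
          ((strip_hasDerivWithinAt_left hG (Ioo_subset_Icc_self hx) hτ').hasDerivAt
            (Icc_mem_nhds hx.1 hx.2)).deriv] at h
      rw [intervalIntegral.integral_add (intervalIntegrable_slice hDF hτ')
        (intervalIntegrable_slice hDG hτ'), hflux, intervalIntegral.integral_const_mul] at hle
      rw [mul_assoc, ← mul_add]
      refine mul_nonpos_of_nonneg_of_nonpos (Real.exp_pos _).le ?_
      linarith [hbd τ hτ]
  have h := hanti self_mem_Ici ht ht
  simp only [sub_self, mul_zero, Real.exp_zero, one_mul] at h
  calc ∫ x in (0 : ℝ)..1, F x t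
      = Real.exp (-c * (t - s)) * (Real.exp (c * (t - s)) * ∫ x in (0 : ℝ)..1, F x t) := by
        rw [← mul_assoc, ← Real.exp_add]; simp
    _ ≤ _ := mul_le_mul_of_nonneg_left h (Real.exp_pos _).le

/-! ### Density of `C₀¹` in `L²(0,1)` -/

/-- Cutting a bounded function off near the ends of `(0,1)` changes it little in `L²`. -/
lemma exists_cutoff_eLpNorm_sub_le {E : Type*} [NormedAddCommGroup E] [NormedSpace ℝ E]
    {g : ℝ → E} {C : ℝ} (hC : ∀ x, ‖g x‖ ≤ C) {ε : ENNReal} (hε : ε ≠ 0) :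
    ∃ χ : ContDiffBump (1 / 2 : ℝ), χ.rOut < 1 / 2 ∧
      eLpNorm (fun x => χ x • g x - g x) 2 (volume.restrict (Ioo (0 : ℝ) 1)) ≤ ε := by
  have hlim : Tendsto (fun δ : ℝ => ‖C‖ₑ * ENNReal.ofReal (4 * δ) ^ (1 / (2 : ENNReal).toReal))
      (𝓝[>] 0) (𝓝 0) := by
    have h0 : Tendsto (fun δ : ℝ => ENNReal.ofReal (4 * δ)) (𝓝[>] 0) (𝓝 0) := by
      have : Tendsto (fun δ : ℝ => ENNReal.ofReal (4 * δ)) (𝓝 0) (𝓝 (ENNReal.ofReal (4 * 0))) :=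
        (ENNReal.continuous_ofReal.comp (by fun_prop)).tendsto 0
      simpa using this.mono_left nhdsWithin_le_nhds
    have h1 := h0.ennrpow_const (1 / (2 : ENNReal).toReal)
    rw [ENNReal.zero_rpow_of_pos (by norm_num)] at h1
    simpa using ENNReal.Tendsto.const_mul h1 (Or.inr enorm_ne_top)
  have hsmall : ∀ᶠ δ : ℝ in 𝓝[>] 0, δ < 1 / 8 :=
    mem_nhdsWithin_of_mem_nhds (Iio_mem_nhds (by norm_num))
  obtain ⟨δ, hδε, hδ8, hδ0⟩ := ((hlim.eventually_le_const (pos_iff_ne_zero.2 hε)).and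
    (hsmall.and self_mem_nhdsWithin)).exists
  have hδ0 : 0 < δ := hδ0
  let χ : ContDiffBump (1 / 2 : ℝ) := ⟨1 / 2 - 2 * δ, 1 / 2 - δ, by linarith, by linarith⟩
  refine ⟨χ, by change 1 / 2 - δ < 1 / 2; linarith, le_trans ?_ hδε⟩
  -- Off `S` the cutoff equals `1`, and `S` meets `(0,1)` in a set of measure at most `4 δ`.
  let S : Set ℝ := Iio (2 * δ) ∪ Ioi (1 - 2 * δ)
  have hS : MeasurableSet S := measurableSet_Iio.union measurableSet_Ioi
  calc eLpNorm (fun x => χ x • g x - g x) 2 (volume.restrict (Ioo (0 : ℝ) 1))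
      ≤ eLpNorm (S.indicator fun _ => C) 2 (volume.restrict (Ioo (0 : ℝ) 1)) := by
        refine eLpNorm_mono fun x => ?_
        by_cases hx : x ∈ S
        · rw [indicator_of_mem hx]
          have h1 : ‖χ x • g x - g x‖ = |1 - χ x| * ‖g x‖ := by
            rw [norm_sub_rev, ← Real.norm_eq_abs, ← norm_smul, sub_smul, one_smul]
          rw [h1, abs_of_nonneg (by linarith [χ.le_one (x := x)])]
          calc (1 - χ x) * ‖g x‖ ≤ 1 * ‖g x‖ := by
                gcongr
                linarith [χ.nonneg (x := x)]
            _ ≤ ‖C‖ := by rw [one_mul]; exact (hC x).trans (le_abs_self C)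
        · have hx' : 2 * δ ≤ x ∧ x ≤ 1 - 2 * δ := by simpa [S] using hx
          have h1 : χ x = 1 := by
            refine χ.one_of_mem_closedBall ?_
            change dist x (1 / 2) ≤ 1 / 2 - 2 * δ
            rw [Real.dist_eq, abs_le]
            constructor <;> linarith
          simp [h1]
    _ ≤ ‖C‖ₑ * ENNReal.ofReal (4 * δ) ^ (1 / (2 : ENNReal).toReal) := by
        refine (eLpNorm_indicator_const_le _ _).trans ?_
        gcongr
        rw [Measure.restrict_apply hS]
        calc volume (S ∩ Ioo 0 1) ≤ volume (Ioo 0 (2 * δ) ∪ Ioo (1 - 2 * δ) 1) := by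
              refine measure_mono ?_
              rintro x ⟨hx | hx, h0, h1⟩
              · exact Or.inl ⟨h0, hx⟩
              · exact Or.inr ⟨hx, h1⟩
          _ ≤ volume (Ioo 0 (2 * δ)) + volume (Ioo (1 - 2 * δ) 1) := measure_union_le _ _
          _ = ENNReal.ofReal (4 * δ) := by
              rw [Real.volume_Ioo, Real.volume_Ioo, ← ENNReal.ofReal_add (by linarith)
                (by linarith)]
              ring_nf

lemma exists_isC01_eLpNorm_sub_le {n : ℕ} (φ : L2 n) {ε : ℝ} (hε : 0 < ε) :
    ∃ ψ : ℝ → Vec n, IsC01 ψ ∧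
      eLpNorm (fun x => ψ x - φ x) 2 (volume.restrict (Ioo (0 : ℝ) 1)) ≤ ENNReal.ofReal ε := by
  obtain ⟨g, hgs, hg, hgφ⟩ := (Lp.memLp φ).exist_eLpNorm_sub_le ENNReal.ofNat_ne_top
    one_le_two (half_pos hε)
  obtain ⟨C, hC⟩ := hgs.exists_bound_of_continuous hg.continuous
  obtain ⟨χ, hχ, hχg⟩ := exists_cutoff_eLpNorm_sub_le hC
    (ENNReal.ofReal_pos.2 (half_pos hε)).ne'
  have hχc : ContDiff ℝ 1 χ := χ.contDiff
  refine ⟨fun x => χ x • g x, ⟨hχc.smul (hg.of_le (by simp)), ?_⟩, ?_⟩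
  · refine (tsupport_smul_subset_left (fun x => χ x) g).trans ?_
    change tsupport χ ⊆ _
    rw [χ.tsupport_eq, Real.closedBall_eq_Icc]
    exact Icc_subset_Ioo (by linarith) (by linarith)
  · have hsplit : (fun x => χ x • g x - φ x)
        = (fun x => χ x • g x - g x) + fun x => g x - φ x := by
      ext1 x; simp
    have hgm : AEStronglyMeasurable g (volume.restrict (Ioo (0 : ℝ) 1)) :=
      hg.continuous.aestronglyMeasurable
    have hχm : AEStronglyMeasurable (fun x => χ x • g x) (volume.restrict (Ioo (0 : ℝ) 1)) :=
      (hχc.continuous.smul hg.continuous).aestronglyMeasurable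
    rw [hsplit]
    refine (eLpNorm_add_le (hχm.sub hgm) (hgm.sub (Lp.aestronglyMeasurable φ)) one_le_two).trans ?_
    have h2 : eLpNorm (fun x => g x - φ x) 2 (volume.restrict (Ioo (0 : ℝ) 1))
        ≤ ENNReal.ofReal (ε / 2) := by
      have := eLpNorm_sub_comm (φ : ℝ → Vec n) g 2 (volume.restrict (Ioo (0 : ℝ) 1))
      rw [this] at hgφ
      exact hgφ
    calc _ ≤ ENNReal.ofReal (ε / 2) + ENNReal.ofReal (ε / 2) := add_le_add hχg h2
      _ = ENNReal.ofReal ε := by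
        rw [← ENNReal.ofReal_add (half_pos hε).le (half_pos hε).le, add_halves]

lemma exists_seq_isC01_tendsto {n : ℕ} (φ : L2 n) :
    ∃ φl : ℕ → ℝ → Vec n, (∀ l, IsC01 (φl l)) ∧
      Tendsto (fun l => eLpNorm (fun x => φl l x - φ x) 2 (volume.restrict (Ioo (0 : ℝ) 1)))
        atTop (𝓝 0) := by
  choose ψ hψ hψφ using fun l : ℕ =>
    exists_isC01_eLpNorm_sub_le φ (Nat.one_div_pos_of_nat (α := ℝ) (n := l))
  refine ⟨ψ, hψ, tendsto_of_tendsto_of_tendsto_of_le_of_le tendsto_const_nhds ?_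
    (fun _ => zero_le) hψφ⟩
  simpa using ENNReal.tendsto_ofReal (tendsto_one_div_add_atTop_nhds_zero_nat (𝕜 := ℝ))

/-! ### Quadratic forms -/

variable {n : ℕ}

lemma diagonal_mulVec_dotProduct (d v : Fin n → ℝ) :
    (Matrix.diagonal d *ᵥ v) ⬝ᵥ v = ∑ j, d j * v j ^ 2 := by
  simp only [dotProduct, Matrix.mulVec_diagonal]
  exact Finset.sum_congr rfl fun j _ => by ring

lemma transpose_mul_diagonal_mul_mulVec_dotProduct (J : Matrix (Fin n) (Fin n) ℝ)
    (d e v : Fin n → ℝ) :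
    ((Jᵀ * Matrix.diagonal d * Matrix.diagonal e * J) *ᵥ v) ⬝ᵥ v
      = ∑ j, d j * e j * (J *ᵥ v) j ^ 2 := by
  rw [← Matrix.mulVec_mulVec, Matrix.mul_assoc, Matrix.diagonal_mul_diagonal,
    ← Matrix.mulVec_mulVec, Matrix.mulVec_transpose, ← Matrix.dotProduct_mulVec,
    diagonal_mulVec_dotProduct]

lemma lyapunov_mulVec_dotProduct (p q d : Fin n → ℝ) (b : Matrix (Fin n) (Fin n) ℝ)
    (v : Fin n → ℝ) :
    ((Matrix.diagonal p + Matrix.diagonal q - Matrix.diagonal d * b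
        - bᵀ * Matrix.diagonal d) *ᵥ v) ⬝ᵥ v
      = ∑ j, (p j + q j) * v j ^ 2 - 2 * ∑ j, d j * v j * (b *ᵥ v) j := by
  have h1 : ((Matrix.diagonal d * b) *ᵥ v) ⬝ᵥ v = ∑ j, d j * v j * (b *ᵥ v) j := by
    rw [← Matrix.mulVec_mulVec]
    simp only [dotProduct, Matrix.mulVec_diagonal]
    exact Finset.sum_congr rfl fun j _ => by ring
  have h2 : ((bᵀ * Matrix.diagonal d) *ᵥ v) ⬝ᵥ v = ∑ j, d j * v j * (b *ᵥ v) j := by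
    rw [← Matrix.mulVec_mulVec, Matrix.mulVec_transpose, ← Matrix.dotProduct_mulVec]
    simp only [dotProduct, Matrix.mulVec_diagonal]
  rw [Matrix.sub_mulVec, Matrix.sub_mulVec, sub_dotProduct, sub_dotProduct, h1, h2,
    Matrix.diagonal_add, diagonal_mulVec_dotProduct]
  ring

lemma sq_apply_le_norm_sq (v : Fin n → ℝ) (j : Fin n) : v j ^ 2 ≤ ‖v‖ ^ 2 :=
  sq_le_sq' (abs_le.1 (norm_le_pi_norm v j)).1 (abs_le.1 (norm_le_pi_norm v j)).2

lemma sum_mul_sq_le {c : ℝ} (hc : 0 ≤ c) {d : Fin n → ℝ} (hd : ∀ j, d j ≤ c) (v : Fin n → ℝ) :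
    ∑ j, d j * v j ^ 2 ≤ n * c * ‖v‖ ^ 2 := by
  calc ∑ j, d j * v j ^ 2 ≤ ∑ _j : Fin n, c * ‖v‖ ^ 2 :=
        Finset.sum_le_sum fun j _ => mul_le_mul (hd j) (sq_apply_le_norm_sq v j) (sq_nonneg _) hc
    _ = _ := by simp; ring

lemma abs_mulVec_le (M : Matrix (Fin n) (Fin n) ℝ) (v : Fin n → ℝ) (j : Fin n) :
    |(M *ᵥ v) j| ≤ (∑ k, |M j k|) * ‖v‖ := by
  rw [Finset.sum_mul]
  refine (Finset.abs_sum_le_sum_abs (fun k => M j k * v k) Finset.univ).trans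
    (Finset.sum_le_sum fun k _ => ?_)
  rw [abs_mul]
  exact mul_le_mul_of_nonneg_left (norm_le_pi_norm v k) (abs_nonneg _)

lemma abs_sum_mul_mulVec_le {β c : ℝ} {d : Fin n → ℝ} (hd : ∀ j, |d j| ≤ β)
    {M : Matrix (Fin n) (Fin n) ℝ} (hM : ∀ j k, |M j k| ≤ c) (v : Fin n → ℝ) :
    |∑ j, d j * v j * (M *ᵥ v) j| ≤ n ^ 2 * (β * c) * ‖v‖ ^ 2 := by
  calc |∑ j, d j * v j * (M *ᵥ v) j| ≤ ∑ j, |d j * v j * (M *ᵥ v) j| :=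
        Finset.abs_sum_le_sum_abs _ _
    _ ≤ ∑ _j : Fin n, β * ‖v‖ * (n * c * ‖v‖) := by
        refine Finset.sum_le_sum fun j _ => ?_
        have hβ : 0 ≤ β := (abs_nonneg _).trans (hd j)
        rw [abs_mul, abs_mul]
        refine mul_le_mul (mul_le_mul (hd j) (norm_le_pi_norm v j) (abs_nonneg _) hβ) ?_
          (abs_nonneg _) (mul_nonneg hβ (norm_nonneg _))
        refine (abs_mulVec_le M v j).trans (mul_le_mul_of_nonneg_right ?_ (norm_nonneg _))
        calc ∑ k, |M j k| ≤ ∑ _k : Fin n, c := Finset.sum_le_sum fun k _ => hM j k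
          _ = n * c := by simp
    _ = _ := by simp; ring

/-- The bounds of the form at the unit vectors, which have maximum norm `1`, are bounds of its
coefficients. -/
lemma diagonal_entry_mem_Icc {β₁ β₂ : ℝ} {d : Fin n → ℝ}
    (h : ∀ v : Fin n → ℝ, β₁ * ‖v‖ ^ 2 ≤ (Matrix.diagonal d *ᵥ v) ⬝ᵥ v ∧
      (Matrix.diagonal d *ᵥ v) ⬝ᵥ v ≤ β₂ * ‖v‖ ^ 2) (j : Fin n) : d j ∈ Icc β₁ β₂ := by
  have h' := h (Pi.single j 1)
  have hn : ‖(Pi.single j 1 : Fin n → ℝ)‖ = 1 := by rw [Pi.norm_single, norm_one]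
  rw [diagonal_mulVec_dotProduct, hn] at h'
  simpa [Pi.single_apply, mem_Icc] using h'

/-! ### Norms of matrix functions on the strip -/

lemma abs_le_bcNorm {B : ℝ → ℝ → Matrix (Fin n) (Fin n) ℝ}
    (hB : ∀ i j, BddOnStrip fun x t => B x t i j) {x : ℝ} (hx : x ∈ Icc (0 : ℝ) 1) (t : ℝ)
    (i j : Fin n) : |B x t i j| ≤ bcNorm B := by
  choose C hC using hB
  have hbdd : BddAbove (range fun q : (Icc (0 : ℝ) 1 × ℝ) × (Fin n × Fin n) =>
      |B q.1.1 q.1.2 q.2.1 q.2.2|) := by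
    refine ⟨∑ i, ∑ j, |C i j|, ?_⟩
    rintro _ ⟨⟨⟨y, τ⟩, ⟨k, l⟩⟩, rfl⟩
    calc |B y τ k l| ≤ |C k l| := (hC k l y y.2 τ).trans (le_abs_self _)
      _ ≤ ∑ l, |C k l| := Finset.single_le_sum (f := fun l => |C k l|)
          (fun _ _ => abs_nonneg _) (Finset.mem_univ l)
      _ ≤ ∑ k, ∑ l, |C k l| := Finset.single_le_sum (f := fun k => ∑ l, |C k l|)
          (fun _ _ => Finset.sum_nonneg fun _ _ => abs_nonneg _) (Finset.mem_univ k)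
  exact le_ciSup hbdd ((⟨x, hx⟩, t), (i, j))

lemma bcNorm_nonneg (B : ℝ → ℝ → Matrix (Fin n) (Fin n) ℝ) : 0 ≤ bcNorm B :=
  Real.iSup_nonneg fun _ => abs_nonneg _

lemma BddOnStrip.sub {f g : ℝ → ℝ → ℝ} (hf : BddOnStrip f) (hg : BddOnStrip g) :
    BddOnStrip fun x t => f x t - g x t := by
  obtain ⟨C, hC⟩ := hf
  obtain ⟨D, hD⟩ := hg
  exact ⟨C + D, fun x hx t => (abs_sub _ _).trans (add_le_add (hC x hx t) (hD x hx t))⟩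

lemma IsC1.differentiableWithinAt_left {f : ℝ → ℝ → ℝ} (hf : IsC1 f) {x : ℝ}
    (hx : x ∈ Icc (0 : ℝ) 1) (t : ℝ) : DifferentiableWithinAt ℝ (fun y => f y t) (Icc 0 1) x :=
  ((hf.differentiableOn one_ne_zero) (x, t) ⟨hx, mem_univ t⟩).comp
    (f := fun y : ℝ => (y, t)) x (by fun_prop) (fun _ hy => ⟨hy, mem_univ t⟩)

lemma IsC1.differentiableAt_right {f : ℝ → ℝ → ℝ} (hf : IsC1 f) {x : ℝ}
    (hx : x ∈ Icc (0 : ℝ) 1) (t : ℝ) : DifferentiableAt ℝ (fun τ => f x τ) t := by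
  rw [← differentiableWithinAt_univ]
  exact ((hf.differentiableOn one_ne_zero) (x, t) ⟨hx, mem_univ t⟩).comp
    (f := fun τ : ℝ => (x, τ)) t (by fun_prop) (fun τ _ => ⟨hx, mem_univ τ⟩)

lemma IsC1.mul {f g : ℝ → ℝ → ℝ} (hf : IsC1 f) (hg : IsC1 g) :
    IsC1 fun x t => f x t * g x t :=
  ContDiffOn.mul (f := fun p : ℝ × ℝ => f p.1 p.2) (g := fun p : ℝ × ℝ => g p.1 p.2) hf hg

lemma dx_sub {f g : ℝ → ℝ → ℝ} (hf : IsC1 f) (hg : IsC1 g) {x : ℝ} (hx : x ∈ Icc (0 : ℝ) 1)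
    (t : ℝ) : dx (fun y τ => f y τ - g y τ) x t = dx f x t - dx g x t :=
  derivWithin_fun_sub (hf.differentiableWithinAt_left hx t) (hg.differentiableWithinAt_left hx t)

lemma dx_mul {f g : ℝ → ℝ → ℝ} (hf : IsC1 f) (hg : IsC1 g) {x : ℝ} (hx : x ∈ Icc (0 : ℝ) 1)
    (t : ℝ) : dx (fun y τ => f y τ * g y τ) x t = dx f x t * g x t + f x t * dx g x t :=
  derivWithin_fun_mul (hf.differentiableWithinAt_left hx t) (hg.differentiableWithinAt_left hx t)

lemma IsBC1.abs_sub_le_of_bc1Norm_le {B B' : ℝ → ℝ → Matrix (Fin n) (Fin n) ℝ} (hB' : IsBC1 B')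
    (hB : IsBC1 B) {γ : ℝ} (h : bc1Norm (fun x t => B' x t - B x t) ≤ γ) {x : ℝ}
    (hx : x ∈ Icc (0 : ℝ) 1) (t : ℝ) (i j : Fin n) : |B' x t i j - B x t i j| ≤ γ := by
  have h1 := abs_le_bcNorm (B := fun x t => B' x t - B x t)
    (fun i j => (hB' i j).2.1.sub (hB i j).2.1) hx t i j
  have h2 := bcNorm_nonneg (dxM fun x t => B' x t - B x t)
  have h3 := bcNorm_nonneg (dtM fun x t => B' x t - B x t)
  exact h1.trans (by unfold bc1Norm at h; linarith)

lemma IsBC1.abs_dx_sub_le_of_bc1Norm_le {B B' : ℝ → ℝ → Matrix (Fin n) (Fin n) ℝ}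
    (hB' : IsBC1 B') (hB : IsBC1 B) {γ : ℝ} (h : bc1Norm (fun x t => B' x t - B x t) ≤ γ) {x : ℝ}
    (hx : x ∈ Icc (0 : ℝ) 1) (t : ℝ) (i j : Fin n) :
    |dx (fun y τ => B' y τ i j - B y τ i j) x t| ≤ γ := by
  have hbdd : ∀ i j, BddOnStrip fun x t => dxM (fun x t => B' x t - B x t) x t i j := by
    intro i j
    obtain ⟨C, hC⟩ := (hB' i j).2.2.1.sub (hB i j).2.2.1
    refine ⟨C, fun y hy τ => ?_⟩
    have hle : |dx (fun x t => B' x t i j) y τ - dx (fun x t => B x t i j) y τ| ≤ C := hC y hy τ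
    rwa [← dx_sub (hB' i j).1 (hB i j).1 hy τ] at hle
  have h1 := abs_le_bcNorm hbdd hx t i j
  have h2 := bcNorm_nonneg (fun x t => B' x t - B x t)
  have h3 := bcNorm_nonneg (dtM fun x t => B' x t - B x t)
  exact h1.trans (by unfold bc1Norm at h; linarith)

lemma IsBC1.isC1_diagonal {a : ℝ → ℝ → Fin n → ℝ} (ha : IsBC1 (diagM a)) (j : Fin n) :
    IsC1 fun x t => a x t j := by
  simpa [diagM] using (ha j j).1

lemma dtM_diagM (V : ℝ → ℝ → Fin n → ℝ) (x t : ℝ) :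
    dtM (diagM V) x t = Matrix.diagonal fun j => dt (fun y τ => V y τ j) x t := by
  ext i j
  by_cases hij : i = j
  · subst hij
    simp [dtM, diagM]
  · simp [dtM, diagM, dt, hij]

lemma dxM_diagM_mul_diagM (V a : ℝ → ℝ → Fin n → ℝ) (x t : ℝ) :
    dxM (fun y τ => diagM V y τ * diagM a y τ) x t
      = Matrix.diagonal fun j => dx (fun y τ => V y τ j * a y τ j) x t := by
  ext i j
  by_cases hij : i = j
  · subst hij
    simp [dxM, diagM]
  · simp [dxM, diagM, dx, hij]

/-! ### Stability of the Lyapunov inequalities under perturbations -/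

/-- The `x`-derivative of `V (a' - a)` is small when `a' - a` is small in `C¹`: only the
derivative of `V` in `x` enters, so no bound for `∂ₜV` is needed. -/
lemma dx_mul_sub_le {V a a' : ℝ → ℝ → ℝ} (hV : IsC1 V) (ha : IsC1 a) (ha' : IsC1 a')
    {x t C β γ : ℝ} (hx : x ∈ Icc (0 : ℝ) 1) (hC : |dx V x t| ≤ C) (hβ : |V x t| ≤ β)
    (h0 : |a' x t - a x t| ≤ γ) (h1 : |dx (fun y τ => a' y τ - a y τ) x t| ≤ γ) :
    dx (fun y τ => V y τ * a' y τ) x t - dx (fun y τ => V y τ * a y τ) x t ≤ (C + β) * γ := by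
  rw [dx_sub ha' ha hx] at h1
  rw [dx_mul hV ha' hx, dx_mul hV ha hx]
  have e1 : |dx V x t * (a' x t - a x t)| ≤ C * γ := by
    rw [abs_mul]
    exact mul_le_mul hC h0 (abs_nonneg _) ((abs_nonneg _).trans hC)
  have e2 : |V x t * (dx a' x t - dx a x t)| ≤ β * γ := by
    rw [abs_mul]
    exact mul_le_mul hβ h1 (abs_nonneg _) ((abs_nonneg _).trans hβ)
  have e3 := le_of_abs_le e1
  have e4 := le_of_abs_le e2
  linear_combination e3 + e4

/-- A small change of `b` and of `q = ∂ₓ(Va)` uses up at most half of the dissipation `β₃ ‖v‖²`;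
the other half dominates a multiple of `⟨Vv, v⟩ ≤ β₂ ‖v‖²`. -/
lemma interior_form_perturb {p q q' d : Fin n → ℝ} {b b' : Matrix (Fin n) (Fin n) ℝ}
    {β₂ β₃ C γ : ℝ} (hβ₂ : 0 < β₂) (hβ₃ : 0 < β₃) (hC : 0 ≤ C) (hγ : 0 ≤ γ)
    (hd : ∀ j, |d j| ≤ β₂) (hq : ∀ j, q' j - q j ≤ C * γ) (hb : ∀ j k, |b' j k - b j k| ≤ γ)
    (hsmall : (n * C + 2 * n ^ 2 * β₂) * γ ≤ β₃ / 2) (v : Fin n → ℝ)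
    (hV : ∑ j, d j * v j ^ 2 ≤ β₂ * ‖v‖ ^ 2)
    (h : ∑ j, (p j + q j) * v j ^ 2 - 2 * ∑ j, d j * v j * (b *ᵥ v) j ≤ -β₃ * ‖v‖ ^ 2) :
    ∑ j, (p j + q' j) * v j ^ 2 - 2 * ∑ j, d j * v j * (b' *ᵥ v) j
      ≤ -(β₃ / (2 * β₂)) * ∑ j, d j * v j ^ 2 := by
  have e1 := sum_mul_sq_le (mul_nonneg hC hγ) hq v
  have e2 := abs_sum_mul_mulVec_le hd (M := b' - b) hb v
  have s1 : ∑ j, (p j + q' j) * v j ^ 2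
      = ∑ j, (p j + q j) * v j ^ 2 + ∑ j, (q' j - q j) * v j ^ 2 := by
    rw [← Finset.sum_add_distrib]
    exact Finset.sum_congr rfl fun j _ => by ring
  have s2 : ∑ j, d j * v j * (b' *ᵥ v) j
      = ∑ j, d j * v j * (b *ᵥ v) j + ∑ j, d j * v j * ((b' - b) *ᵥ v) j := by
    rw [← Finset.sum_add_distrib, Matrix.sub_mulVec]
    exact Finset.sum_congr rfl fun j _ => by simp only [Pi.sub_apply]; ring
  have e3 := (abs_le.1 e2).1
  have e4 := mul_le_mul_of_nonneg_right hsmall (sq_nonneg ‖v‖)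
  have e5 : β₃ / (2 * β₂) * ∑ j, d j * v j ^ 2 ≤ β₃ / 2 * ‖v‖ ^ 2 := by
    calc _ ≤ β₃ / (2 * β₂) * (β₂ * ‖v‖ ^ 2) := mul_le_mul_of_nonneg_left hV (by positivity)
      _ = _ := by field_simp
  rw [s1, s2]
  linarith

lemma abs_sum_mul_sq_mulVec_le {β γ : ℝ} {d e : Fin n → ℝ} (hd : ∀ j, |d j| ≤ β)
    (he : ∀ j, |e j| ≤ γ) (J : Matrix (Fin n) (Fin n) ℝ) (v : Fin n → ℝ) :
    |∑ j, d j * e j * (J *ᵥ v) j ^ 2| ≤ β * γ * (∑ j, (∑ k, |J j k|) ^ 2) * ‖v‖ ^ 2 := by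
  rw [Finset.mul_sum, Finset.sum_mul]
  refine (Finset.abs_sum_le_sum_abs _ _).trans (Finset.sum_le_sum fun j _ => ?_)
  rw [abs_mul, abs_mul, mul_assoc (β * γ), ← mul_pow, abs_pow]
  have hβ : 0 ≤ β := (abs_nonneg _).trans (hd j)
  have hγ : 0 ≤ γ := (abs_nonneg _).trans (he j)
  exact mul_le_mul (mul_le_mul (hd j) (he j) (abs_nonneg _) hβ)
    (pow_le_pow_left₀ (abs_nonneg _) (abs_mulVec_le J v j) 2) (by positivity)
    (mul_nonneg hβ hγ)

/-- A small change of the diagonal matrices `a₀`, `a₁` cannot turn the strictly negative boundary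
form into a positive one. -/
lemma boundary_form_perturb {d₀ d₁ a₀ a₁ a₀' a₁' : Fin n → ℝ} {J₀ J₁ : Matrix (Fin n) (Fin n) ℝ}
    {β₂ β₄ γ : ℝ} (hd₀ : ∀ j, |d₀ j| ≤ β₂) (hd₁ : ∀ j, |d₁ j| ≤ β₂)
    (ha₀ : ∀ j, |a₀' j - a₀ j| ≤ γ) (ha₁ : ∀ j, |a₁' j - a₁ j| ≤ γ)
    (hsmall : β₂ * (∑ j, (∑ k, |J₀ j k|) ^ 2 + ∑ j, (∑ k, |J₁ j k|) ^ 2) * γ ≤ β₄)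
    (v : Fin n → ℝ)
    (h : ∑ j, d₀ j * a₀ j * (J₀ *ᵥ v) j ^ 2 - ∑ j, d₁ j * a₁ j * (J₁ *ᵥ v) j ^ 2
      ≤ -β₄ * ‖v‖ ^ 2) :
    ∑ j, d₀ j * a₀' j * (J₀ *ᵥ v) j ^ 2 ≤ ∑ j, d₁ j * a₁' j * (J₁ *ᵥ v) j ^ 2 := by
  have split : ∀ (d a a' : Fin n → ℝ) (w : Fin n → ℝ), ∑ j, d j * a' j * w j ^ 2
      = ∑ j, d j * a j * w j ^ 2 + ∑ j, d j * (a' j - a j) * w j ^ 2 := by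
    intro d a a' w
    rw [← Finset.sum_add_distrib]
    exact Finset.sum_congr rfl fun j _ => by ring
  have e0 := (abs_le.1 (abs_sum_mul_sq_mulVec_le hd₀ ha₀ J₀ v)).2
  have e1 := (abs_le.1 (abs_sum_mul_sq_mulVec_le hd₁ ha₁ J₁ v)).1
  have e2 := mul_le_mul_of_nonneg_right hsmall (sq_nonneg ‖v‖)
  rw [split d₀ a₀ a₀', split d₁ a₁ a₁']
  linarith

/-! ### Decay of classical solutions -/

/-- The values of `u` on the part of the boundary that enters the reflection conditions:
`u_k(1)` for `k ≤ m` and `u_k(0)` for `k > m`. -/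
def outTrace (m : ℕ) (v : ℝ → Vec n) (k : Fin n) : ℝ :=
  if (k : ℕ) < m then v 1 k else v 0 k

lemma mulVec_outTrace (m : ℕ) (r : Matrix (Fin n) (Fin n) ℝ) (v : ℝ → Vec n) (j : Fin n) :
    (r *ᵥ outTrace m v) j = R m r j v := by
  simp only [Matrix.mulVec, dotProduct, R, outTrace, mul_ite]

lemma J0_mulVec_outTrace {m : ℕ} {r : Matrix (Fin n) (Fin n) ℝ} {v : ℝ → Vec n}
    (h : ∀ j : Fin n, (j : ℕ) < m → v 0 j = R m r j v) (j : Fin n) :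
    (J0 m r *ᵥ outTrace m v) j = v 0 j := by
  by_cases hj : (j : ℕ) < m
  · rw [h j hj, ← mulVec_outTrace]
    simp [Matrix.mulVec, dotProduct, J0, hj]
  · have : (J0 m r *ᵥ outTrace m v) j = ((1 : Matrix (Fin n) (Fin n) ℝ) *ᵥ outTrace m v) j := by
      simp only [Matrix.mulVec, dotProduct, J0, Matrix.of_apply, hj, if_false]
    rw [this, Matrix.one_mulVec, outTrace, if_neg hj]

lemma J1_mulVec_outTrace {m : ℕ} {r : Matrix (Fin n) (Fin n) ℝ} {v : ℝ → Vec n}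
    (h : ∀ j : Fin n, m ≤ (j : ℕ) → v 1 j = R m r j v) (j : Fin n) :
    (J1 m r *ᵥ outTrace m v) j = v 1 j := by
  by_cases hj : (j : ℕ) < m
  · have : (J1 m r *ᵥ outTrace m v) j = ((1 : Matrix (Fin n) (Fin n) ℝ) *ᵥ outTrace m v) j := by
      simp only [Matrix.mulVec, dotProduct, J1, Matrix.of_apply, hj, if_true]
    rw [this, Matrix.one_mulVec, outTrace, if_pos hj]
  · rw [h j (not_lt.1 hj), ← mulVec_outTrace]
    simp [Matrix.mulVec, dotProduct, J1, hj]

lemma contDiffOn_sum_mul_sq {W : ℝ → ℝ → Fin n → ℝ} (hW : ∀ j, IsC1 fun x t => W x t j)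
    {u : ℝ → ℝ → Vec n} {s : ℝ}
    (hu : ContDiffOn ℝ 1 (fun p : ℝ × ℝ => u p.1 p.2) (Icc (0 : ℝ) 1 ×ˢ Ici s)) :
    ContDiffOn ℝ 1 (fun p : ℝ × ℝ => ∑ j, W p.1 p.2 j * u p.1 p.2 j ^ 2)
      (Icc (0 : ℝ) 1 ×ˢ Ici s) :=
  ContDiffOn.sum fun j _ => ((hW j).mono (prod_mono_right (subset_univ _))).mul
    ((contDiffOn_piLp 2).1 hu j |>.pow 2)

variable {m : ℕ} {r : Matrix (Fin n) (Fin n) ℝ} {a : ℝ → ℝ → Fin n → ℝ}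
  {b : ℝ → ℝ → Matrix (Fin n) (Fin n) ℝ} {s : ℝ} {φ : ℝ → Vec n} {u : ℝ → ℝ → Vec n}

/-- Along a classical solution, the energy density `⟨Vu, u⟩` and its flux `⟨Vau, u⟩` satisfy
`∂ₜ⟨Vu, u⟩ + ∂ₓ⟨Vau, u⟩ = ⟨(∂ₜV + ∂ₓ(Va) - Vb - bᵀV)u, u⟩`. -/
lemma IsClassicalSolution.energy_identity (hu : IsClassicalSolution m r a b s φ u)
    {V : ℝ → ℝ → Fin n → ℝ} (hV : ∀ j, IsC1 fun x t => V x t j)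
    (ha : ∀ j, IsC1 fun x t => a x t j) {x t : ℝ} (hx : x ∈ Ioo (0 : ℝ) 1) (ht : t ∈ Ioi s) :
    deriv (fun τ => ∑ j, V x τ j * u x τ j ^ 2) t
        + deriv (fun y => ∑ j, V y t j * a y t j * u y t j ^ 2) x
      = ∑ j, (dt (fun y τ => V y τ j) x t + dx (fun y τ => V y τ j * a y τ j) x t) * u x t j ^ 2
        - 2 * ∑ j, V x t j * u x t j * (b x t *ᵥ (u x t).ofLp) j := by
  have hxI : x ∈ Icc (0 : ℝ) 1 := Ioo_subset_Icc_self hx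
  have hnx : Icc (0 : ℝ) 1 ∈ 𝓝 x := Icc_mem_nhds hx.1 hx.2
  have huj : ∀ j, ContDiffOn ℝ 1 (fun p : ℝ × ℝ => u p.1 p.2 j) (Icc (0 : ℝ) 1 ×ˢ Ici s) :=
    (contDiffOn_piLp 2).1 hu.contDiffOn
  have hut : ∀ j, HasDerivAt (fun τ => u x τ j) (deriv (fun τ => u x τ j) t) t := fun j =>
    (strip_hasDerivAt_right (F := fun x t => u x t j) (huj j) hxI ht).differentiableAt.hasDerivAt
  have hux : ∀ j, HasDerivAt (fun y => u y t j) (deriv (fun y => u y t j) x) x := fun j =>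
    ((strip_hasDerivWithinAt_left (F := fun x t => u x t j) (huj j) hxI
      (mem_Ioi.1 ht).le).hasDerivAt hnx).differentiableAt.hasDerivAt
  have hVt : ∀ j, HasDerivAt (fun τ => V x τ j) (dt (fun y τ => V y τ j) x t) t := fun j =>
    ((hV j).differentiableAt_right hxI t).hasDerivAt
  have hVa : ∀ j, HasDerivAt (fun y => V y t j * a y t j)
      (dx (fun y τ => V y τ j * a y τ j) x t) x := fun j =>
    (((hV j).mul (ha j)).differentiableWithinAt_left hxI t).hasDerivWithinAt.hasDerivAt hnx
  have h1 := HasDerivAt.fun_sum (u := Finset.univ) fun j _ => (hVt j).mul ((hut j).pow 2)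
  have h2 := HasDerivAt.fun_sum (u := Finset.univ) fun j _ => (hVa j).mul ((hux j).pow 2)
  have e1 := h1.deriv
  have e2 := h2.deriv
  simp only [Pi.mul_apply, Pi.pow_apply] at e1 e2
  rw [e1, e2, Finset.mul_sum, ← Finset.sum_add_distrib, ← Finset.sum_sub_distrib]
  refine Finset.sum_congr rfl fun j _ => ?_
  have heq : deriv (fun τ => u x τ j) t + a x t j * deriv (fun y => u y t j) x
      + (b x t *ᵥ (u x t).ofLp) j = 0 := hu.equation x hx t ht j
  push_cast
  linear_combination 2 * V x t j * u x t j * heq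

lemma IsClassicalSolution.energy_le (hu : IsClassicalSolution m r a b s φ u)
    {V : ℝ → ℝ → Fin n → ℝ} (hV : ∀ j, IsC1 fun x t => V x t j)
    (ha : ∀ j, IsC1 fun x t => a x t j) {c : ℝ}
    (hint : ∀ x ∈ Icc (0 : ℝ) 1, ∀ t : ℝ, ∀ v : Fin n → ℝ,
      ∑ j, (dt (fun y τ => V y τ j) x t + dx (fun y τ => V y τ j * a y τ j) x t) * v j ^ 2
        - 2 * ∑ j, V x t j * v j * (b x t *ᵥ v) j ≤ -c * ∑ j, V x t j * v j ^ 2)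
    (hbd : ∀ t : ℝ, ∀ v : Fin n → ℝ, ∑ j, V 0 t j * a 0 t j * (J0 m r *ᵥ v) j ^ 2
      ≤ ∑ j, V 1 t j * a 1 t j * (J1 m r *ᵥ v) j ^ 2) {t : ℝ} (ht : s ≤ t) :
    ∫ x in (0 : ℝ)..1, ∑ j, V x t j * u x t j ^ 2
      ≤ Real.exp (-c * (t - s)) * ∫ x in (0 : ℝ)..1, ∑ j, V x s j * u x s j ^ 2 := by
  refine integral_le_exp_of_dissipation (F := fun x t => ∑ j, V x t j * u x t j ^ 2)
    (G := fun x t => ∑ j, V x t j * a x t j * u x t j ^ 2)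
    (contDiffOn_sum_mul_sq hV hu.contDiffOn)
    (contDiffOn_sum_mul_sq (W := fun x t j => V x t j * a x t j) (fun j => (hV j).mul (ha j))
      hu.contDiffOn) (fun x hx τ hτ => ?_) (fun τ hτ => ?_) ht
  · rw [hu.energy_identity hV ha hx hτ]
    exact hint x (Ioo_subset_Icc_self hx) τ (u x τ).ofLp
  · have h := hbd τ (outTrace m fun x => u x τ)
    simpa only [J0_mulVec_outTrace (v := fun x => u x τ) (hu.boundary_left τ (mem_Ioi.1 hτ).le),
      J1_mulVec_outTrace (v := fun x => u x τ) (hu.boundary_right τ (mem_Ioi.1 hτ).le)] using h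

lemma aestronglyMeasurable_of_continuousOn_Icc {E : Type*} [NormedAddCommGroup E] {f : ℝ → E}
    (hf : ContinuousOn f (Icc 0 1)) :
    AEStronglyMeasurable f (volume.restrict (Ioo (0 : ℝ) 1)) :=
  (hf.mono Ioo_subset_Icc_self).aestronglyMeasurable measurableSet_Ioo

lemma eLpNorm_two_eq_sqrt_integral {E : Type*} [NormedAddCommGroup E] {f : ℝ → E}
    (hf : ContinuousOn f (Icc 0 1)) :
    eLpNorm f 2 (volume.restrict (Ioo (0 : ℝ) 1))
      = ENNReal.ofReal √(∫ x in (0 : ℝ)..1, ‖f x‖ ^ 2) := by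
  have hmem : MemLp f 2 (volume.restrict (Ioo (0 : ℝ) 1)) := by
    rw [memLp_two_iff_integrable_sq_norm (aestronglyMeasurable_of_continuousOn_Icc hf)]
    exact ((hf.norm.pow 2).integrableOn_Icc).mono_set Ioo_subset_Icc_self
  rw [hmem.eLpNorm_eq_integral_rpow_norm two_ne_zero ENNReal.ofNat_ne_top,
    intervalIntegral.integral_of_le zero_le_one, integral_Ioc_eq_integral_Ioo, Real.sqrt_eq_rpow]
  simp

/-- Since `β₁ |u|² ≤ ⟨Vu, u⟩ ≤ β₂ |u|²`, exponential decay of `∫ ⟨Vu, u⟩` at rate `c` gives decay of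
the `L²` norm at rate `c / 2`. -/
lemma IsClassicalSolution.eLpNorm_le (hu : IsClassicalSolution m r a b s φ u)
    {V : ℝ → ℝ → Fin n → ℝ} (hV : ∀ j, IsC1 fun x t => V x t j) {β₁ β₂ c t : ℝ} (hβ₁ : 0 < β₁)
    (hVβ : ∀ x ∈ Icc (0 : ℝ) 1, ∀ t : ℝ, ∀ j, V x t j ∈ Icc β₁ β₂) (ht : s ≤ t)
    (hE : ∫ x in (0 : ℝ)..1, ∑ j, V x t j * u x t j ^ 2
      ≤ Real.exp (-c * (t - s)) * ∫ x in (0 : ℝ)..1, ∑ j, V x s j * u x s j ^ 2) :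
    eLpNorm (fun x => u x t) 2 (volume.restrict (Ioo (0 : ℝ) 1))
      ≤ ENNReal.ofReal (√(β₂ / β₁) * Real.exp (-(c / 2) * (t - s)))
        * eLpNorm φ 2 (volume.restrict (Ioo (0 : ℝ) 1)) := by
  have hφ : eLpNorm φ 2 (volume.restrict (Ioo (0 : ℝ) 1))
      = eLpNorm (fun x => u x s) 2 (volume.restrict (Ioo (0 : ℝ) 1)) := by
    refine eLpNorm_congr_ae ?_
    filter_upwards [ae_restrict_mem measurableSet_Ioo] with x hx
    exact (hu.initial x (Ioo_subset_Icc_self hx)).symm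
  have hcont : ∀ τ, s ≤ τ → ContinuousOn (fun x => u x τ) (Icc 0 1) := fun τ hτ =>
    continuousOn_slice hu.contDiffOn.continuousOn hτ
  have hi : ∀ τ, s ≤ τ → IntervalIntegrable (fun x => ‖u x τ‖ ^ 2) volume 0 1 := fun τ hτ =>
    ContinuousOn.intervalIntegrable (by
      rw [uIcc_of_le zero_le_one]
      exact (hcont τ hτ).norm.pow 2)
  have hiV : ∀ τ, s ≤ τ → IntervalIntegrable (fun x => ∑ j, V x τ j * u x τ j ^ 2) volume 0 1 :=
    fun τ hτ => intervalIntegrable_slice (contDiffOn_sum_mul_sq hV hu.contDiffOn).continuousOn hτ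
  have hlow : β₁ * ∫ x in (0 : ℝ)..1, ‖u x t‖ ^ 2
      ≤ ∫ x in (0 : ℝ)..1, ∑ j, V x t j * u x t j ^ 2 := by
    rw [← intervalIntegral.integral_const_mul]
    refine intervalIntegral.integral_mono_on zero_le_one ((hi t ht).const_mul _) (hiV t ht)
      fun x hx => ?_
    rw [EuclideanSpace.real_norm_sq_eq, Finset.mul_sum]
    exact Finset.sum_le_sum fun j _ =>
      mul_le_mul_of_nonneg_right (hVβ x hx t j).1 (sq_nonneg _)
  have hup : ∫ x in (0 : ℝ)..1, ∑ j, V x s j * u x s j ^ 2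
      ≤ β₂ * ∫ x in (0 : ℝ)..1, ‖u x s‖ ^ 2 := by
    rw [← intervalIntegral.integral_const_mul]
    refine intervalIntegral.integral_mono_on zero_le_one (hiV s le_rfl)
      ((hi s le_rfl).const_mul _) fun x hx => ?_
    rw [EuclideanSpace.real_norm_sq_eq, Finset.mul_sum]
    exact Finset.sum_le_sum fun j _ =>
      mul_le_mul_of_nonneg_right (hVβ x hx s j).2 (sq_nonneg _)
  rw [hφ, eLpNorm_two_eq_sqrt_integral (hcont t ht), eLpNorm_two_eq_sqrt_integral (hcont s le_rfl),
    ← ENNReal.ofReal_mul (by positivity)]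
  refine ENNReal.ofReal_le_ofReal ?_
  have hexp : Real.exp (-(c / 2) * (t - s)) = √(Real.exp (-c * (t - s))) := by
    rw [← Real.exp_half]
    ring_nf
  have hnn : 0 ≤ ∫ x in (0 : ℝ)..1, ‖u x s‖ ^ 2 :=
    intervalIntegral.integral_nonneg zero_le_one fun x _ => sq_nonneg _
  rw [hexp, mul_assoc, ← Real.sqrt_mul (Real.exp_pos _).le, ← Real.sqrt_mul']
  · refine Real.sqrt_le_sqrt ?_
    rw [div_mul_eq_mul_div, le_div_iff₀ hβ₁]
    have := mul_le_mul_of_nonneg_left hup (Real.exp_pos (-c * (t - s))).le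
    linarith
  · positivity

/-! ### Passage to generalized solutions -/

/-- A bound for the `L²` norm of classical solutions by their initial values carries over to
generalized solutions. -/
lemma IsL2GeneralizedSolution.norm_le {φ : L2 n} {u : ℝ → L2 n}
    (hu : IsL2GeneralizedSolution m r a b s φ u) {t C : ℝ} (ht : s ≤ t) (hC : 0 ≤ C)
    (hcl : ∀ (ψ : ℝ → Vec n) (w : ℝ → ℝ → Vec n), IsClassicalSolution m r a b s ψ w →
      eLpNorm (fun x => w x t) 2 (volume.restrict (Ioo (0 : ℝ) 1))
        ≤ ENNReal.ofReal C * eLpNorm ψ 2 (volume.restrict (Ioo (0 : ℝ) 1))) :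
    ‖u t‖ ≤ C * ‖φ‖ := by
  obtain ⟨φl, hφl, hlim⟩ := exists_seq_isC01_tendsto φ
  obtain ⟨ul, hul, hconv⟩ := hu.2 φl hφl hlim
  set μ : Measure ℝ := volume.restrict (Ioo (0 : ℝ) 1) with hμ
  have hφtop : eLpNorm φ 2 μ ≠ ⊤ := Lp.eLpNorm_ne_top φ
  have hbound : ∀ ε > (0 : ℝ), ∀ᶠ l in atTop, eLpNorm (u t) 2 μ
      ≤ ENNReal.ofReal ε + ENNReal.ofReal C
        * (eLpNorm (fun x => φl l x - φ x) 2 μ + eLpNorm φ 2 μ) := by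
    intro ε hε
    filter_upwards [hconv (t - s + 1) (by linarith) ε hε] with l hl
    have hw : AEStronglyMeasurable (fun x => ul l x t) μ :=
      aestronglyMeasurable_of_continuousOn_Icc
        (continuousOn_slice (hul l).contDiffOn.continuousOn ht)
    have hφlm : AEStronglyMeasurable (φl l) μ := (hφl l).1.continuous.aestronglyMeasurable
    calc eLpNorm (u t) 2 μ
        = eLpNorm ((fun x => u t x - ul l x t) + fun x => ul l x t) 2 μ := by
          congr 1; ext1 x; simp
      _ ≤ eLpNorm (fun x => u t x - ul l x t) 2 μ + eLpNorm (fun x => ul l x t) 2 μ :=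
          eLpNorm_add_le ((Lp.aestronglyMeasurable (u t)).sub hw) hw one_le_two
      _ ≤ ENNReal.ofReal ε + ENNReal.ofReal C * eLpNorm (φl l) 2 μ :=
          add_le_add (hl t ⟨ht, by linarith⟩) (hcl _ _ (hul l))
      _ ≤ _ := by
          gcongr
          calc eLpNorm (φl l) 2 μ = eLpNorm ((fun x => φl l x - φ x) + (φ : ℝ → Vec n)) 2 μ := by
                congr 1; ext1 x; simp
            _ ≤ _ := eLpNorm_add_le (hφlm.sub (Lp.aestronglyMeasurable φ))
                (Lp.aestronglyMeasurable φ) one_le_two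
  have hε : ∀ ε > (0 : ℝ), eLpNorm (u t) 2 μ
      ≤ ENNReal.ofReal ε + ENNReal.ofReal C * eLpNorm φ 2 μ := by
    intro ε hε
    have hl : Tendsto (fun l => ENNReal.ofReal ε + ENNReal.ofReal C
        * (eLpNorm (fun x => φl l x - φ x) 2 μ + eLpNorm φ 2 μ)) atTop
        (𝓝 (ENNReal.ofReal ε + ENNReal.ofReal C * (0 + eLpNorm φ 2 μ))) :=
      tendsto_const_nhds.add (ENNReal.Tendsto.const_mul (hlim.add tendsto_const_nhds)
        (Or.inr ENNReal.ofReal_ne_top))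
    rw [zero_add] at hl
    exact ge_of_tendsto hl (hbound ε hε)
  rw [Lp.norm_def, Lp.norm_def]
  refine le_of_forall_pos_le_add fun ε hpos => ?_
  have h := ENNReal.toReal_mono (by finiteness) (hε ε hpos)
  rw [ENNReal.toReal_add (by finiteness) (by finiteness), ENNReal.toReal_mul,
    ENNReal.toReal_ofReal hpos.le, ENNReal.toReal_ofReal hC] at h
  linarith

end HypStrip

/-! ### Robust exponential stability -/

open HypStrip in
theorem mainTheorem4 (n m : ℕ) (hm : m ≤ n) (r : Matrix (Fin n) (Fin n) ℝ)
    (a : ℝ → ℝ → Fin n → ℝ) (b : ℝ → ℝ → Matrix (Fin n) (Fin n) ℝ)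
    (ha : HypStrip.IsBC1 (HypStrip.diagM a)) (hb : HypStrip.IsBC1 b)
    (β₁ β₂ β₃ β₄ : ℝ) (hβ₁ : 0 < β₁) (hβ₂ : 0 < β₂) (hβ₃ : 0 < β₃) (hβ₄ : 0 < β₄)
    (V : ℝ → ℝ → Fin n → ℝ)
    (hV : ∀ j, HypStrip.IsC1 (fun x t => V x t j))
    (hVx : ∀ j, HypStrip.BddOnStrip (HypStrip.dx fun x t => V x t j))
    (h1 : ∀ x ∈ Icc (0 : ℝ) 1, ∀ t : ℝ, ∀ v : Fin n → ℝ,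
      β₁ * ‖v‖ ^ 2 ≤ (HypStrip.diagM V x t *ᵥ v) ⬝ᵥ v ∧
        (HypStrip.diagM V x t *ᵥ v) ⬝ᵥ v ≤ β₂ * ‖v‖ ^ 2)
    (h2 : ∀ x ∈ Icc (0 : ℝ) 1, ∀ t : ℝ, ∀ v : Fin n → ℝ,
      ((HypStrip.dtM (HypStrip.diagM V) x t
          + HypStrip.dxM (fun y τ => HypStrip.diagM V y τ * HypStrip.diagM a y τ) x t
          - HypStrip.diagM V x t * b x t - (b x t)ᵀ * HypStrip.diagM V x t) *ᵥ v) ⬝ᵥ v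
        ≤ -β₃ * ‖v‖ ^ 2)
    (h3 : ∀ t : ℝ, ∀ v : Fin n → ℝ,
      (((HypStrip.J0 m r)ᵀ * HypStrip.diagM V 0 t * HypStrip.diagM a 0 t * HypStrip.J0 m r
          - (HypStrip.J1 m r)ᵀ * HypStrip.diagM V 1 t * HypStrip.diagM a 1 t
            * HypStrip.J1 m r) *ᵥ v) ⬝ᵥ v
        ≤ -β₄ * ‖v‖ ^ 2) :
    HypStrip.RobustExpStable m r a b := by
  have hVβ : ∀ x ∈ Icc (0 : ℝ) 1, ∀ t : ℝ, ∀ j, V x t j ∈ Icc β₁ β₂ := fun x hx t j =>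
    diagonal_entry_mem_Icc (h1 x hx t) j
  have hVabs : ∀ x ∈ Icc (0 : ℝ) 1, ∀ t : ℝ, ∀ j, |V x t j| ≤ β₂ := fun x hx t j => by
    rw [abs_of_pos (hβ₁.trans_le (hVβ x hx t j).1)]
    exact (hVβ x hx t j).2
  choose D hD using hVx
  let C : ℝ := ∑ j, |D j|
  have hC : 0 ≤ C := Finset.sum_nonneg fun j _ => abs_nonneg _
  have hVC : ∀ x ∈ Icc (0 : ℝ) 1, ∀ t : ℝ, ∀ j, |dx (fun x t => V x t j) x t| ≤ C :=
    fun x hx t j => (hD j x hx t).trans ((le_abs_self _).trans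
      (Finset.single_le_sum (f := fun j => |D j|) (fun _ _ => abs_nonneg _) (Finset.mem_univ j)))
  let K : ℝ := ∑ j, (∑ k, |J0 m r j k|) ^ 2 + ∑ j, (∑ k, |J1 m r j k|) ^ 2
  have hK : 0 ≤ K := by positivity
  let N : ℝ := n * (C + β₂) + 2 * n ^ 2 * β₂
  have hN : 0 ≤ N := by positivity
  -- The `+ 1` keeps the denominators positive when `N` or `K` vanishes.
  let γ : ℝ := min (β₃ / 2 / (N + 1)) (β₄ / (β₂ * K + 1))
  have hγ : 0 < γ := by positivity
  have hγN : N * γ ≤ β₃ / 2 := by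
    calc N * γ ≤ (N + 1) * (β₃ / 2 / (N + 1)) :=
          mul_le_mul (by linarith) (min_le_left _ _) hγ.le (by positivity)
      _ = β₃ / 2 := mul_div_cancel₀ _ (by positivity)
  have hγK : β₂ * K * γ ≤ β₄ := by
    calc β₂ * K * γ ≤ (β₂ * K + 1) * (β₄ / (β₂ * K + 1)) :=
          mul_le_mul (by linarith) (min_le_right _ _) hγ.le (by positivity)
      _ = β₄ := mul_div_cancel₀ _ (by positivity)
  -- For `n = 0` nothing forces `β₁ ≤ β₂`, so `√(β₂ / β₁)` alone need not be at least `1`.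
  refine ⟨γ, hγ, max 1 √(β₂ / β₁), le_max_left _ _, β₃ / (2 * β₂) / 2, by positivity, ?_⟩
  intro s φ a' b' ha' hb' haa' hbb' u hu t ht
  have hint : ∀ x ∈ Icc (0 : ℝ) 1, ∀ t : ℝ, ∀ v : Fin n → ℝ,
      ∑ j, (dt (fun y τ => V y τ j) x t + dx (fun y τ => V y τ j * a' y τ j) x t) * v j ^ 2
        - 2 * ∑ j, V x t j * v j * (b' x t *ᵥ v) j
        ≤ -(β₃ / (2 * β₂)) * ∑ j, V x t j * v j ^ 2 := by
    intro x hx t v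
    have hform := h2 x hx t v
    rw [dtM_diagM, dxM_diagM_mul_diagM, diagM, lyapunov_mulVec_dotProduct] at hform
    refine interior_form_perturb (C := C + β₂) hβ₂ hβ₃ (by positivity) hγ.le (hVabs x hx t)
      (fun j => ?_) (fun j k => hb'.abs_sub_le_of_bc1Norm_le hb hbb' hx t j k) hγN v
      (by simpa [diagM, diagonal_mulVec_dotProduct] using (h1 x hx t v).2) hform
    have e0 := ha'.abs_sub_le_of_bc1Norm_le ha haa' hx t j j
    have e1 := ha'.abs_dx_sub_le_of_bc1Norm_le ha haa' hx t j j
    simp only [diagM, Matrix.diagonal_apply_eq] at e0 e1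
    exact dx_mul_sub_le (hV j) (ha.isC1_diagonal j) (ha'.isC1_diagonal j) hx (hVC x hx t j)
      (hVabs x hx t j) e0 e1
  have hbd : ∀ t : ℝ, ∀ v : Fin n → ℝ, ∑ j, V 0 t j * a' 0 t j * (J0 m r *ᵥ v) j ^ 2
      ≤ ∑ j, V 1 t j * a' 1 t j * (J1 m r *ᵥ v) j ^ 2 := by
    intro t v
    have hform := h3 t v
    simp only [diagM] at hform
    rw [Matrix.sub_mulVec, sub_dotProduct, transpose_mul_diagonal_mul_mulVec_dotProduct,
      transpose_mul_diagonal_mul_mulVec_dotProduct] at hform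
    have hx0 : (0 : ℝ) ∈ Icc (0 : ℝ) 1 := left_mem_Icc.2 zero_le_one
    have hx1 : (1 : ℝ) ∈ Icc (0 : ℝ) 1 := right_mem_Icc.2 zero_le_one
    refine boundary_form_perturb (γ := γ) (hVabs 0 hx0 t) (hVabs 1 hx1 t) (fun j => ?_)
      (fun j => ?_) hγK v hform
    · simpa [diagM] using ha'.abs_sub_le_of_bc1Norm_le ha haa' hx0 t j j
    · simpa [diagM] using ha'.abs_sub_le_of_bc1Norm_le ha haa' hx1 t j j
  have hnorm := hu.norm_le ht (by positivity) fun ψ w hw =>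
    hw.eLpNorm_le hV hβ₁ hVβ ht (hw.energy_le hV ha'.isC1_diagonal hint hbd ht)
  refine hnorm.trans ?_
  gcongr
  exact le_max_right _ _
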